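/- Let $a, b \geq 1$ be real numbers and let $X$ be a random variable with the Beta distribution with parameters $a$ and $b$, that is, the distribution on the unit interval with density $x^{a-1}(1-x)^{b-1}/B(a,b)$ for $x \in (0,1)$, where $B(a,b) = \int_0^1 y^{a-1}(1-y)^{b-1}\,dy$. Then $$e^{-1} < \left(\frac{b}{1+b}\right)^{b} \leq \mathbb{P}(X \geq \mathbb{E}(X)) \leq 1 - \left(\frac{a}{1+a}\right)^{a} < 1 - e^{-1}.$$ -/

import Mathlib

open MeasureTheory ProbabilityTheory Set

/-! This is a Grünbaum-type argument. Let `G` be the unnormalised upper tail and `m` the mean. The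
function `G ^ b⁻¹` is concave on the unit interval (`concaveOn_betaTail_rpow`), so Jensen gives
`E[G(X) ^ b⁻¹] ≤ G(m) ^ b⁻¹`. Since `G' = -betaKernel`, the left side integrates exactly to `b / (1
+ b) * G(0) ^ b⁻¹`; raising to the power `b` gives the lower bound. The reflection `x ↦ 1 - x`
exchanges `a` and `b` and turns it into the upper bound. -/

/-- The unnormalised density of the Beta distribution. -/
noncomputable def betaKernel (a b x : ℝ) : ℝ := x ^ (a - 1) * (1 - x) ^ (b - 1)

/-- The unnormalised upper tail of the Beta distribution. -/
noncomputable def betaTail (a b t : ℝ) : ℝ := ∫ x in t..1, betaKernel a b x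

/-! ### Calculus of the density and its tail -/

section Kernel

variable {a b : ℝ}

lemma continuous_betaKernel (ha : 1 ≤ a) (hb : 1 ≤ b) : Continuous (betaKernel a b) := by
  unfold betaKernel
  exact (Real.continuous_rpow_const (by linarith)).mul
    ((Real.continuous_rpow_const (by linarith)).comp (continuous_const.sub continuous_id))

lemma betaKernel_pos {x : ℝ} (hx : x ∈ Ioo (0 : ℝ) 1) : 0 < betaKernel a b x :=
  mul_pos (Real.rpow_pos_of_pos hx.1 _) (Real.rpow_pos_of_pos (by linarith [hx.2]) _)

lemma betaKernel_one_sub (x : ℝ) : betaKernel a b (1 - x) = betaKernel b a x := by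
  simp [betaKernel, mul_comm]

lemma hasDerivAt_betaKernel {x : ℝ} (hx : x ∈ Ioo (0 : ℝ) 1) :
    HasDerivAt (betaKernel a b)
      (betaKernel a b x * ((a - 1) / x - (b - 1) / (1 - x))) x := by
  have h0 : x ≠ 0 := hx.1.ne'
  have h1 : 1 - x ≠ 0 := by linarith [hx.2]
  have hl := (hasDerivAt_id x).rpow_const (p := a - 1) (Or.inl h0)
  have hr := ((hasDerivAt_id x).const_sub 1).rpow_const (p := b - 1) (Or.inl h1)
  refine (hl.mul hr).congr_deriv ?_
  simp only [id, betaKernel, Real.rpow_sub_one h0 (a - 1), Real.rpow_sub_one h1 (b - 1)]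
  field_simp
  ring

lemma hasDerivAt_betaTail (ha : 1 ≤ a) (hb : 1 ≤ b) (t : ℝ) :
    HasDerivAt (betaTail a b) (-betaKernel a b t) t := by
  have hk := continuous_betaKernel ha hb
  exact intervalIntegral.integral_hasDerivAt_left (hk.intervalIntegrable _ _)
    (hk.stronglyMeasurableAtFilter _ _) hk.continuousAt

lemma continuous_betaTail (ha : 1 ≤ a) (hb : 1 ≤ b) : Continuous (betaTail a b) :=
  continuous_iff_continuousAt.2 fun t => (hasDerivAt_betaTail ha hb t).continuousAt

@[simp] lemma betaTail_one : betaTail a b 1 = 0 := by simp [betaTail]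

lemma betaTail_pos (ha : 1 ≤ a) (hb : 1 ≤ b) {t : ℝ} (ht : t ∈ Ico (0 : ℝ) 1) :
    0 < betaTail a b t :=
  intervalIntegral.intervalIntegral_pos_of_pos_on
    ((continuous_betaKernel ha hb).intervalIntegrable _ _)
    (fun _ hx => betaKernel_pos ⟨ht.1.trans_lt hx.1, hx.2⟩) ht.2

lemma betaTail_nonneg (ha : 1 ≤ a) (hb : 1 ≤ b) {t : ℝ} (ht : t ∈ Icc (0 : ℝ) 1) :
    0 ≤ betaTail a b t := by
  rcases ht.2.eq_or_lt with rfl | h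
  · simp
  · exact (betaTail_pos ha hb ⟨ht.1, h⟩).le

lemma betaTail_swap (ha : 1 ≤ a) (hb : 1 ≤ b) (t : ℝ) :
    betaTail b a (1 - t) = betaTail a b 0 - betaTail a b t := by
  have hk := continuous_betaKernel ha hb
  have h : betaTail b a (1 - t) = ∫ x in (0 : ℝ)..t, betaKernel a b x := by
    simp only [betaTail, ← betaKernel_one_sub (a := a) (b := b)]
    rw [intervalIntegral.integral_comp_sub_left (fun x => betaKernel a b x)]
    simp
  rw [h, betaTail, betaTail, eq_sub_iff_add_eq]
  exact intervalIntegral.integral_add_adjacent_intervals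
    (hk.intervalIntegrable _ _) (hk.intervalIntegrable _ _)

/-- An upper bound for the tail in terms of the density, to the right of the mode. -/
lemma mul_betaTail_le (ha : 1 ≤ a) (hb : 1 ≤ b) {t : ℝ} (ht : t ∈ Ioo (0 : ℝ) 1) :
    b * ((b - 1) * t - (a - 1) * (1 - t)) * betaTail a b t
      ≤ (b - 1) * (t * (1 - t) * betaKernel a b t) := by
  have hkt : 0 < betaKernel a b t := betaKernel_pos ht
  have h1t : 0 < 1 - t := by linarith [ht.2]
  rcases le_or_gt ((b - 1) * t - (a - 1) * (1 - t)) 0 with hN | hN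
  -- Here the left side is nonpositive and the right side nonnegative.
  · have hG := betaTail_pos ha hb ⟨ht.1.le, ht.2⟩
    have hR : 0 ≤ (b - 1) * (t * (1 - t) * betaKernel a b t) :=
      mul_nonneg (by linarith) (mul_pos (mul_pos ht.1 h1t) hkt).le
    exact (mul_nonpos_of_nonpos_of_nonneg
      (mul_nonpos_of_nonneg_of_nonpos (by linarith) hN) hG.le).trans hR
  let N : ℝ → ℝ := fun x => (b - 1) * x - (a - 1) * (1 - x)
  have hNpos : ∀ x ∈ Icc t 1, 0 < N x := fun x hx => by
    have : 0 ≤ (a + b - 2) * (x - t) := mul_nonneg (by linarith) (by linarith [hx.1])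
    simp only [N]
    linarith
  have hNd : ∀ x, HasDerivAt N (a + b - 2) x := fun x => by
    refine (((hasDerivAt_id x).const_mul (b - 1)).sub
      (((hasDerivAt_id x).const_sub 1).const_mul (a - 1))).congr_deriv ?_
    ring
  have hk := continuous_betaKernel ha hb
  -- The claim is `0 ≤ R t`. As `R` vanishes at `1`, it suffices that `R` decreases on `[t, 1]`,
  -- where `N` stays positive because its slope `a + b - 2` is nonnegative.
  let R : ℝ → ℝ := fun x =>
    (b - 1) * (x * (1 - x) * betaKernel a b x) / N x - b * betaTail a b x
  have hRc : ContinuousOn R (Icc t 1) := by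
    refine ContinuousOn.sub (ContinuousOn.div ?_ ?_ fun x hx => (hNpos x hx).ne') ?_
    · fun_prop
    · fun_prop
    · exact (continuous_const.mul (continuous_betaTail ha hb)).continuousOn
  have hRd : ∀ x ∈ Ioo t 1, HasDerivAt R
      (-(betaKernel a b x * (a - 1) * (1 - x) * (N x + (b - 1)) / N x ^ 2)) x := by
    intro x hx
    have hx' : x ∈ Ioo (0 : ℝ) 1 := ⟨ht.1.trans hx.1, hx.2⟩
    have hNx := (hNpos x ⟨hx.1.le, hx.2.le⟩).ne'
    have h0 : x ≠ 0 := hx'.1.ne'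
    have h1 : 1 - x ≠ 0 := by linarith [hx'.2]
    have hd := ((((((hasDerivAt_id x).mul ((hasDerivAt_id x).const_sub 1)).mul
      (hasDerivAt_betaKernel (a := a) (b := b) hx')).const_mul (b - 1)).div (hNd x) hNx).sub
      ((hasDerivAt_betaTail ha hb x).const_mul b))
    refine hd.congr_deriv ?_
    simp only [id, Pi.mul_apply]
    field_simp
    simp only [N]
    ring
  have hanti : AntitoneOn R (Icc t 1) := by
    refine antitoneOn_of_deriv_nonpos (convex_Icc t 1) hRc ?_ ?_
    · rw [interior_Icc]
      exact fun x hx => (hRd x hx).differentiableAt.differentiableWithinAt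
    · rw [interior_Icc]
      intro x hx
      have hx' : x ∈ Ioo (0 : ℝ) 1 := ⟨ht.1.trans hx.1, hx.2⟩
      have hNx := hNpos x ⟨hx.1.le, hx.2.le⟩
      have hkx : 0 < betaKernel a b x := betaKernel_pos hx'
      rw [(hRd x hx).deriv, neg_nonpos]
      have := sub_nonneg.2 ha
      have := sub_nonneg.2 hb
      have := sub_nonneg.2 hx.2.le
      positivity
  have hR := hanti (left_mem_Icc.2 ht.2.le) (right_mem_Icc.2 ht.2.le) ht.2.le
  simp only [R, sub_self, mul_zero, zero_mul, zero_div, betaTail_one] at hR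
  rw [sub_nonneg, le_div_iff₀ hN] at hR
  linarith

/-- The second derivative is a positive multiple of the difference of the two sides of
`mul_betaTail_le`. -/
lemma concaveOn_betaTail_rpow (ha : 1 ≤ a) (hb : 1 ≤ b) :
    ConcaveOn ℝ (Icc 0 1) fun t => betaTail a b t ^ b⁻¹ := by
  have hb0 : 0 < b := by linarith
  refine concaveOn_of_hasDerivWithinAt2_nonpos (convex_Icc 0 1)
    (f' := fun t => -betaKernel a b t * b⁻¹ * betaTail a b t ^ (b⁻¹ - 1))
    (f'' := fun t => -(betaKernel a b t * ((a - 1) / t - (b - 1) / (1 - t))) * b⁻¹ *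
      betaTail a b t ^ (b⁻¹ - 1) + -betaKernel a b t * b⁻¹ *
      (-betaKernel a b t * (b⁻¹ - 1) * betaTail a b t ^ (b⁻¹ - 1 - 1))) ?_ ?_ ?_ ?_
  · exact ((continuous_betaTail ha hb).rpow_const fun _ => Or.inr (by positivity)).continuousOn
  · rw [interior_Icc]
    intro t ht
    exact ((hasDerivAt_betaTail ha hb t).rpow_const
      (Or.inl (betaTail_pos ha hb ⟨ht.1.le, ht.2⟩).ne')).hasDerivWithinAt
  · rw [interior_Icc]
    intro t ht
    exact (((hasDerivAt_betaKernel ht).neg.mul_const b⁻¹).mul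
      ((hasDerivAt_betaTail ha hb t).rpow_const
      (Or.inl (betaTail_pos ha hb ⟨ht.1.le, ht.2⟩).ne'))).hasDerivWithinAt
  · rw [interior_Icc]
    intro t ht
    have hG := betaTail_pos ha hb ⟨ht.1.le, ht.2⟩
    have hk : 0 < betaKernel a b t := betaKernel_pos ht
    have h0 : 0 < t := ht.1
    have h1 : 0 < 1 - t := by linarith [ht.2]
    rw [Real.rpow_sub_one hG.ne' (b⁻¹ - 1)]
    have hP := Real.rpow_pos_of_pos hG (b⁻¹ - 1)
    set P := betaTail a b t ^ (b⁻¹ - 1)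
    have hkey := mul_betaTail_le ha hb ht
    have : -(betaKernel a b t * ((a - 1) / t - (b - 1) / (1 - t))) * b⁻¹ * P +
        -betaKernel a b t * b⁻¹ * (-betaKernel a b t * (b⁻¹ - 1) * (P / betaTail a b t)) =
        betaKernel a b t * P / (b ^ 2 * t * (1 - t) * betaTail a b t) *
        (b * ((b - 1) * t - (a - 1) * (1 - t)) * betaTail a b t
          - (b - 1) * (t * (1 - t) * betaKernel a b t)) := by
      field_simp
      ring
    rw [this]
    exact mul_nonpos_of_nonneg_of_nonpos (by positivity) (by linarith)

/-- The integrand is the derivative of a multiple of `betaTail ^ (b⁻¹ + 1)`, which vanishes at `1`.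
-/
lemma integral_betaKernel_mul_betaTail_rpow (ha : 1 ≤ a) (hb : 1 ≤ b) :
    ∫ x in (0 : ℝ)..1, betaKernel a b x * betaTail a b x ^ b⁻¹ =
      b / (1 + b) * betaTail a b 0 ^ (b⁻¹ + 1) := by
  have hb0 : 0 < b := by linarith
  have hc : 0 < b⁻¹ + 1 := by positivity
  have hG := continuous_betaTail ha hb
  have hd : ∀ x ∈ uIcc (0 : ℝ) 1, HasDerivAt
      (fun x => -(b / (1 + b)) * betaTail a b x ^ (b⁻¹ + 1))
      (betaKernel a b x * betaTail a b x ^ b⁻¹) x := fun x _ => by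
    refine (((hasDerivAt_betaTail ha hb x).rpow_const (p := b⁻¹ + 1) (Or.inr ?_)).const_mul
      (-(b / (1 + b)))).congr_deriv ?_
    · have : 0 < b⁻¹ := by positivity
      linarith
    · rw [add_sub_cancel_right]
      field_simp
  have hGc : Continuous fun x => betaTail a b x ^ b⁻¹ :=
    hG.rpow_const fun _ => Or.inr (by positivity)
  rw [intervalIntegral.integral_eq_sub_of_hasDerivAt hd
    (((continuous_betaKernel ha hb).mul hGc).intervalIntegrable _ _)]
  simp [Real.zero_rpow hc.ne']

end Kernel

/-! ### The Beta law, its mean, and Jensen's inequality -/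

section Measure

variable {a b : ℝ}

lemma betaPDFReal_eq_indicator (a b : ℝ) :
    betaPDFReal a b = (Ioo 0 1).indicator fun x => (beta a b)⁻¹ * betaKernel a b x := by
  ext x
  simp [betaPDFReal, betaKernel, indicator, mul_assoc]

lemma toReal_betaPDF (ha : 0 < a) (hb : 0 < b) (x : ℝ) :
    (betaPDF a b x).toReal = (Ioo 0 1).indicator (fun x => (beta a b)⁻¹ * betaKernel a b x) x := by
  rw [betaPDF, ENNReal.toReal_ofReal, betaPDFReal_eq_indicator]
  by_cases hx : 0 < x ∧ x < 1
  · exact (betaPDFReal_pos hx.1 hx.2 ha hb).le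
  · simp [betaPDFReal, hx]

lemma measurable_betaPDF (a b : ℝ) : Measurable (betaPDF a b) :=
  (measurable_betaPDFReal a b).ennreal_ofReal

lemma integral_betaMeasure (ha : 0 < a) (hb : 0 < b) (h : ℝ → ℝ) :
    ∫ x, h x ∂betaMeasure a b = (beta a b)⁻¹ * ∫ x in (0 : ℝ)..1, betaKernel a b x * h x := by
  rw [betaMeasure, integral_withDensity_eq_integral_toReal_smul (measurable_betaPDF a b)
    (by simp [betaPDF]), intervalIntegral.integral_of_le zero_le_one, integral_Ioc_eq_integral_Ioo,
    ← integral_const_mul, ← integral_indicator measurableSet_Ioo]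
  congr 1 with x
  rw [toReal_betaPDF ha hb]
  by_cases hx : x ∈ Ioo (0 : ℝ) 1 <;> simp [hx, mul_assoc]

lemma ae_mem_Icc_betaMeasure (a b : ℝ) : ∀ᵐ x ∂betaMeasure a b, x ∈ Icc (0 : ℝ) 1 := by
  rw [betaMeasure, ae_withDensity_iff (measurable_betaPDF a b)]
  refine ae_of_all _ fun x hx => ?_
  by_contra h
  rw [mem_Icc, not_and_or, not_le, not_le] at h
  exact hx (h.elim (fun h => betaPDF_eq_zero_of_nonpos h.le)
    fun h => betaPDF_eq_zero_of_one_le h.le)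

lemma betaTail_zero (ha : 0 < a) (hb : 0 < b) : betaTail a b 0 = beta a b := by
  have := isProbabilityMeasureBeta ha hb
  have h := integral_betaMeasure ha hb fun _ => 1
  have hB := (beta_pos ha hb).ne'
  simp only [integral_const, probReal_univ, mul_one, smul_eq_mul] at h
  rw [betaTail]
  field_simp at h
  exact h.symm

lemma integrable_betaMeasure_of_continuous (ha : 0 < a) (hb : 0 < b) {h : ℝ → ℝ}
    (hh : Continuous h) : Integrable h (betaMeasure a b) := by
  have := isProbabilityMeasureBeta ha hb
  obtain ⟨C, hC⟩ := (isCompact_Icc (a := (0 : ℝ)) (b := 1)).exists_bound_of_continuousOn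
    hh.continuousOn
  exact Integrable.of_bound hh.aestronglyMeasurable C
    ((ae_mem_Icc_betaMeasure a b).mono fun x hx => hC x hx)

lemma integral_id_betaMeasure_mem_Icc (ha : 0 < a) (hb : 0 < b) :
    ∫ x, x ∂betaMeasure a b ∈ Icc (0 : ℝ) 1 := by
  have := isProbabilityMeasureBeta ha hb
  exact (convex_Icc 0 1).integral_mem isClosed_Icc (ae_mem_Icc_betaMeasure a b)
    (integrable_betaMeasure_of_continuous ha hb continuous_id)

lemma betaMeasure_real_Ici (ha : 0 < a) (hb : 0 < b) {t : ℝ} (ht : t ∈ Icc (0 : ℝ) 1) :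
    (betaMeasure a b).real (Ici t) = betaTail a b t / beta a b := by
  rw [← integral_indicator_one measurableSet_Ici, integral_betaMeasure ha hb, div_eq_inv_mul,
    betaTail, intervalIntegral.integral_of_le zero_le_one, intervalIntegral.integral_of_le ht.2,
    ← integral_Icc_eq_integral_Ioc, ← integral_Icc_eq_integral_Ioc,
    ← integral_indicator measurableSet_Icc, ← integral_indicator measurableSet_Icc]
  congr 2 with x
  by_cases hx : t ≤ x
  · have : 0 ≤ x := ht.1.trans hx
    simp [indicator, hx, this]
  · simp [indicator, hx]

lemma beta_comm (a b : ℝ) : beta a b = beta b a := by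
  simp [beta, mul_comm, add_comm]

lemma integral_id_betaMeasure_swap (ha : 0 < a) (hb : 0 < b) :
    ∫ x, x ∂betaMeasure b a = 1 - ∫ x, x ∂betaMeasure a b := by
  have := isProbabilityMeasureBeta ha hb
  have h : ∫ x, x ∂betaMeasure b a = ∫ x, (1 - x) ∂betaMeasure a b := by
    rw [integral_betaMeasure hb ha, integral_betaMeasure ha hb, beta_comm b a]
    have := intervalIntegral.integral_comp_sub_left (a := 0) (b := 1)
      (fun x => betaKernel a b x * (1 - x)) 1
    simp only [betaKernel_one_sub, sub_sub_cancel, sub_self, sub_zero] at this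
    rw [this]
  rw [h, integral_sub (integrable_const _)
    (integrable_betaMeasure_of_continuous ha hb (h := fun x => x) continuous_id)]
  simp

/-- Grünbaum's inequality for the Beta distribution. -/
lemma le_betaTail_integral_id (ha : 1 ≤ a) (hb : 1 ≤ b) :
    (b / (1 + b)) ^ b ≤ betaTail a b (∫ x, x ∂betaMeasure a b) / beta a b := by
  have ha0 : 0 < a := by linarith
  have hb0 : 0 < b := by linarith
  have := isProbabilityMeasureBeta ha0 hb0
  have hB := beta_pos ha0 hb0
  have hm := integral_id_betaMeasure_mem_Icc ha0 hb0
  set m := ∫ x, x ∂betaMeasure a b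
  have hGc : Continuous fun x => betaTail a b x ^ b⁻¹ :=
    (continuous_betaTail ha hb).rpow_const fun _ => Or.inr (by positivity)
  have hJ : ∫ x, betaTail a b x ^ b⁻¹ ∂betaMeasure a b ≤ betaTail a b m ^ b⁻¹ :=
    (concaveOn_betaTail_rpow ha hb).le_map_integral (f := id) hGc.continuousOn isClosed_Icc
      (ae_mem_Icc_betaMeasure a b) (integrable_betaMeasure_of_continuous ha0 hb0 continuous_id)
      (integrable_betaMeasure_of_continuous ha0 hb0 hGc)
  rw [integral_betaMeasure ha0 hb0, integral_betaKernel_mul_betaTail_rpow ha hb,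
    betaTail_zero ha0 hb0, Real.rpow_add_one hB.ne'] at hJ
  have hJ' : b / (1 + b) * beta a b ^ b⁻¹ ≤ betaTail a b m ^ b⁻¹ := by
    refine le_of_eq_of_le ?_ hJ
    field_simp
  have hP := Real.rpow_le_rpow (by positivity) hJ' hb0.le
  rw [Real.mul_rpow (by positivity) (by positivity), Real.rpow_inv_rpow hB.le hb0.ne',
    Real.rpow_inv_rpow (betaTail_nonneg ha hb hm) hb0.ne'] at hP
  rwa [le_div_iff₀ hB]

end Measure

/-- This is `log y < y - 1` at `y = (1 + b) / b`. -/
lemma exp_neg_one_lt_div_one_add_rpow {b : ℝ} (hb : 0 < b) :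
    Real.exp (-1) < (b / (1 + b)) ^ b := by
  have hpos : 0 < (1 + b) / b := by positivity
  have hne : (1 + b) / b ≠ 1 := by
    rw [Ne, div_eq_one_iff_eq hb.ne']
    linarith
  have hlog := Real.log_lt_sub_one_of_pos hpos hne
  have h1 : (1 + b) / b - 1 = 1 / b := by field_simp; ring
  rw [h1, lt_div_iff₀ hb] at hlog
  rw [Real.rpow_def_of_pos (by positivity), Real.exp_lt_exp, ← inv_div, Real.log_inv]
  linarith

theorem corollary9 {Ω : Type*} [MeasurableSpace Ω] (P : MeasureTheory.Measure Ω)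
    [MeasureTheory.IsProbabilityMeasure P] (X : Ω → ℝ) (a b : ℝ) (ha : 1 ≤ a) (hb : 1 ≤ b)
    (hX : ProbabilityTheory.HasLaw X (ProbabilityTheory.betaMeasure a b) P) :
    MeasureTheory.Integrable X P ∧
    Real.exp (-1) < (b / (1 + b)) ^ b ∧
    (b / (1 + b)) ^ b ≤ P.real {ω | (∫ ω', X ω' ∂P) ≤ X ω} ∧
    P.real {ω | (∫ ω', X ω' ∂P) ≤ X ω} ≤ 1 - (a / (1 + a)) ^ a ∧
    1 - (a / (1 + a)) ^ a < 1 - Real.exp (-1) := by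
  have ha0 : 0 < a := by linarith
  have hb0 : 0 < b := by linarith
  have hB := beta_pos ha0 hb0
  have hint : Integrable X P := by
    have h := integrable_betaMeasure_of_continuous ha0 hb0 continuous_id
    rw [← hX.map_eq] at h
    exact h.comp_aemeasurable hX.aemeasurable
  have hprob : P.real {ω | (∫ ω', X ω' ∂P) ≤ X ω} =
      betaTail a b (∫ x, x ∂betaMeasure a b) / beta a b := by
    rw [hX.integral_eq,
      hX.measureReal_eq (p := fun x => ∫ x, x ∂betaMeasure a b ≤ x) measurableSet_Ici]
    exact betaMeasure_real_Ici ha0 hb0 (integral_id_betaMeasure_mem_Icc ha0 hb0)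
  -- The lower bound with `a` and `b` exchanged, which reflection carries to the complementary tail.
  have hupper := le_betaTail_integral_id hb ha
  rw [integral_id_betaMeasure_swap ha0 hb0, betaTail_swap ha hb, betaTail_zero ha0 hb0,
    beta_comm b a, sub_div, div_self hB.ne'] at hupper
  rw [hprob]
  exact ⟨hint, exp_neg_one_lt_div_one_add_rpow hb0, le_betaTail_integral_id ha hb,
    by linarith, by linarith [exp_neg_one_lt_div_one_add_rpow ha0]⟩
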